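/- Let $G$ be a finitely generated group. For a subset $X$ of $G$ write $X^{*}=G\setminus X$. For a subgroup $H$ of $G$, let $H\backslash G$ be the set of cosets $Hg$, on which $G$ acts on the right. A subset $W\subseteq G$ is *$H$-finite* if it is contained in a union of finitely many cosets $Hg$. A subset $X\subseteq G$ is *$H$-almost invariant* if $hX=X$ for all $h\in H$ and the image $H\backslash X$ of $X$ in $H\backslash G$ has finite symmetric difference with $(H\backslash X)g$ for every $g\in G$; it is *nontrivial* if $H\backslash X$ and $H\backslash X^{*}$ are both infinite. An $H$-almost invariant set $X$ and a $K$-almost invariant set $Y$ are *equivalent* if their symmetric difference is $H$-finite. If $U$ and $V$ are nontrivial almost invariant sets over some subgroups $H$ and $K$, then $U\cap V$ is *small* if it is $H$-finite (this does not depend on the choice of $H$). The *corners* of $(U,V)$ are the four sets $U\cap V$, $U\cap V^{*}$, $U^{*}\cap V$, $U^{*}\cap V^{*}$. For nontrivial almost invariant sets $Y_1,\dots,Y_n$ over finitely generated subgroups of $G$, put $E(Y_1,\dots,Y_n)=\{gY_i,\ gY_i^{*}: g\in G,\ 1\le i\le n\}$; the family is in *good position* if, whenever $U,V\in E(Y_1,\dots,Y_n)$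 have at least two small corners, one of their corners is empty. For $U,V\in E(Y_1,\dots,Y_n)$, write $U\le V$ if $U\cap V^{*}$ is empty or is the only small set among the four corners of $(U,V)$. **Lemma.** Let $G$ be a finitely generated group with finitely generated subgroups $H_1,\dots,H_n$, and for $i=1,\dots,n$ let $X_i$ be a nontrivial $H_i$-almost invariant subset of $G$. Then there are finitely generated subgroups $K_1,\dots,K_n$ of $G$ and nontrivial $K_i$-almost invariant subsets $Y_i$ of $G$ such that each $Y_i$ is equivalent to $X_i$, the family $Y_1,\dots,Y_n$ is in good position, and the relation $\le$ is a partial order on $E(Y_1,\dots,Y_n)$. -/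

import Mathlib

open scoped Pointwise

namespace AlmostInvariant

variable {G : Type*} [Group G]

/-- The set `H \ G` of cosets `Hg`, the quotient of `G` by left multiplication by `H`. -/
abbrev CosetSpace (H : Subgroup G) : Type _ := Quotient (QuotientGroup.rightRel H)

/-- The projection `G → H \ G`, `g ↦ Hg`. -/
def proj (H : Subgroup G) (g : G) : CosetSpace H := Quotient.mk (QuotientGroup.rightRel H) g

/-- The right action of `G` on `H \ G`: the map `Hx ↦ Hxg`. -/
def rightTranslate (H : Subgroup G) (g : G) : CosetSpace H → CosetSpace H :=
  Quotient.map (fun x => x * g) (by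
    intro a b hab
    have h : QuotientGroup.rightRel H a b := hab
    rw [QuotientGroup.rightRel_apply] at h
    change QuotientGroup.rightRel H (a * g) (b * g)
    rw [QuotientGroup.rightRel_apply]
    simpa [mul_assoc] using h)

/-- `P ⊆ H \ G` is almost invariant: `Pg` and `P` differ by a finite set, for every `g`. -/
def IsAlmostInvariantInQuotient (H : Subgroup G) (P : Set (CosetSpace H)) : Prop :=
  ∀ g : G, (symmDiff (rightTranslate H g '' P) P).Finite

/-- `X ⊆ G` is `H`-almost invariant. -/
structure IsAlmostInvariant (H : Subgroup G) (X : Set G) : Prop where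
  left_invariant : ∀ h ∈ H, h • X = X
  almost_invariant : IsAlmostInvariantInQuotient H (proj H '' X)

/-- `X ⊆ G` is a nontrivial `H`-almost invariant set: moreover `H \ X` and `H \ X*` are infinite,
where `X*` is the complement of `X`. -/
structure IsNontrivialAlmostInvariant (H : Subgroup G) (X : Set G) : Prop
    extends IsAlmostInvariant H X where
  infinite : (proj H '' X).Infinite
  infinite_compl : (proj H '' Xᶜ).Infinite

/-- `W` is `H`-finite: it lies in the union of finitely many cosets `Hg`. -/
def IsHFinite (H : Subgroup G) (W : Set G) : Prop :=
  ∃ F : Finset G, W ⊆ (H : Set G) * (F : Set G)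

/-- `V` and `W` are `H`-almost equal. -/
def IsHAlmostEqual (H : Subgroup G) (V W : Set G) : Prop := IsHFinite H (symmDiff V W)

/-- The `H`-almost invariant set `X` and the `K`-almost invariant set `Y` are equivalent. -/
structure IsEquivalent (H K : Subgroup G) (X Y : Set G) : Prop where
  left : IsAlmostInvariant H X
  right : IsAlmostInvariant K Y
  almost_equal : IsHAlmostEqual H X Y

/-- `U ∩ V` is small: it is `H`-finite, where `U` is a nontrivial `H`-almost invariant set.
Any two subgroups over which `U` is nontrivial almost invariant are commensurable,
so it does not matter which such `H` is used. -/
def IsSmall (U V : Set G) : Prop :=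
  ∃ H : Subgroup G, IsNontrivialAlmostInvariant H U ∧ IsHFinite H (U ∩ V)

/-- `U` or its complement `U*`. -/
def side (U : Set G) : Bool → Set G
  | true => U
  | false => Uᶜ

/-- The four corners `U ∩ V`, `U ∩ V*`, `U* ∩ V`, `U* ∩ V*` of the pair `(U, V)`, indexed by
`(true, true)`, `(true, false)`, `(false, true)`, `(false, false)`. -/
def corner (U V : Set G) (c : Bool × Bool) : Set G := side U c.1 ∩ side V c.2

/-- The corner of `(U, V)` with index `c` is small. -/
def CornerSmall (U V : Set G) (c : Bool × Bool) : Prop := IsSmall (side U c.1) (side V c.2)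

/-- `E(X₁, …, Xₙ)`: all translates of the `Xᵢ` and of their complements. -/
def translates {ι : Type*} (X : ι → Set G) : Set (Set G) :=
  {U | ∃ (g : G) (i : ι), U = g • X i ∨ U = g • (X i)ᶜ}

/-- Good position, i.e. Condition (*) for `E(X₁, …, Xₙ)`: if two of the four corners of two members
are small, then one of their corners is empty. -/
def InGoodPosition {ι : Type*} (X : ι → Set G) : Prop :=
  ∀ U ∈ translates X, ∀ V ∈ translates X, ∀ c d : Bool × Bool, c ≠ d →
    CornerSmall U V c → CornerSmall U V d → ∃ e : Bool × Bool, corner U V e = ∅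

/-- The relation `U ≤ V`: the corner `U ∩ V*` is empty, or it is the only small one among the four
corners of `U` and `V`. -/
def AlmostLE (U V : Set G) : Prop :=
  corner U V (true, false) = ∅ ∨ ∀ c : Bool × Bool, CornerSmall U V c ↔ c = (true, false)

end AlmostInvariant

/-!
Replace `X i` by its upward closure for the total preorder on `G` given by the height of `x` above
`y`: the number of translates of the `X j` and their complements that are almost equal to `X i` and
contain `x` but not `y`, minus the number of those that contain `y` but not `x`. Heights add up
along `x`, `y`, `z` and are equivariant, and they depend only on the class of almost equal
translates; as upward closed sets for a total preorder form a chain, almost equal translates of the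
new sets are nested.

The change is `H i`-finite. A point added to `X i` lies in a translate almost equal to `X i` but
crossing it. The boundaries of two almost invariant sets in the Cayley graph have neighborhoods
that are connected and finite modulo the (finitely generated) stabilizing subgroups; if these are
disjoint then one corner of the pair is empty, and almost equal sets with an empty corner are
nested. Hence the neighborhood of a crossing translate meets that of `X i`, which leaves only
finitely many translates up to the action of `H i`; and `H i`-orbits of sets almost equal to `X i`
are finite.

Finally, two small corners are necessarily opposite and make one set almost equal to the other set
or to its complement, so nestedness of almost equal translates gives an empty corner. It also gives
the only delicate case of transitivity, `U ≤ V ≤ W` with `U` almost equal to `W`.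
-/

namespace AlmostInvariant

open MulAction

section HFinite

variable {G : Type*} [Group G] {H L : Subgroup G} {W X Y Z : Set G}

lemma proj_eq_proj_iff {x y : G} : proj H x = proj H y ↔ y * x⁻¹ ∈ H :=
  Quotient.eq.trans QuotientGroup.rightRel_apply

lemma isHFinite_iff_finite_image_proj : IsHFinite H W ↔ (proj H '' W).Finite := by
  classical
  constructor
  · rintro ⟨F, hF⟩
    refine (F.finite_toSet.image (proj H)).subset ?_
    rintro _ ⟨x, hx, rfl⟩
    obtain ⟨h, hh, f, hf, rfl⟩ := Set.mem_mul.1 (hF hx)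
    exact ⟨f, hf, proj_eq_proj_iff.2 (by simpa using hh)⟩
  · intro h
    refine ⟨(h.image Quotient.out).toFinset, fun x hx => ?_⟩
    refine Set.mem_mul.2 ⟨x * (proj H x).out⁻¹, proj_eq_proj_iff.1 (Quotient.out_eq _),
      (proj H x).out, ?_, inv_mul_cancel_right _ _⟩
    simpa using ⟨x, hx, rfl⟩

lemma IsHFinite.mono (hW : IsHFinite H W) (h : Z ⊆ W) : IsHFinite H Z :=
  hW.imp fun _ => h.trans

lemma isHFinite_empty : IsHFinite H (∅ : Set G) := ⟨∅, Set.empty_subset _⟩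

lemma isHFinite_biUnion {ι : Type*} {s : Set ι} (hs : s.Finite) {f : ι → Set G}
    (h : ∀ i ∈ s, IsHFinite H (f i)) : IsHFinite H (⋃ i ∈ s, f i) := by
  simp only [isHFinite_iff_finite_image_proj, Set.image_iUnion₂] at h ⊢
  exact hs.biUnion h

lemma IsHFinite.union (hZ : IsHFinite H Z) (hW : IsHFinite H W) : IsHFinite H (Z ∪ W) := by
  rw [isHFinite_iff_finite_image_proj] at *
  rw [Set.image_union]
  exact hZ.union hW

lemma IsHFinite.preimage_mul_right (hW : IsHFinite H W) (g : G) :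
    IsHFinite H ((· * g) ⁻¹' W) := by
  classical
  obtain ⟨F, hF⟩ := hW
  refine ⟨F.image (· * g⁻¹), fun x hx => ?_⟩
  obtain ⟨h, hh, f, hf, hx⟩ := Set.mem_mul.1 (hF hx)
  exact Set.mem_mul.2 ⟨h, hh, f * g⁻¹, by simpa using hf, by rw [← mul_assoc, hx]; simp⟩

lemma IsHFinite.of_le (hW : IsHFinite H W) (hHL : H ≤ L) : IsHFinite L W :=
  hW.imp fun _ hF => hF.trans (Set.mul_subset_mul_right hHL)

lemma isHFinite_self (H : Subgroup G) : IsHFinite H (H : Set G) := ⟨{1}, by simp⟩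

lemma IsHFinite.trans (hL : IsHFinite H (L : Set G)) (hW : IsHFinite L W) : IsHFinite H W := by
  classical
  obtain ⟨F, hF⟩ := hL
  obtain ⟨F', hF'⟩ := hW
  refine ⟨F * F', hF'.trans ?_⟩
  rw [Finset.coe_mul, ← mul_assoc]
  exact Set.mul_subset_mul_right hF

lemma IsHFinite.smul (h : IsHFinite H W) (g : G) :
    IsHFinite (H.map (MulAut.conj g).toMonoidHom) (g • W) := by
  classical
  obtain ⟨F, hF⟩ := h
  refine ⟨g • F, ?_⟩
  rintro _ ⟨x, hx, rfl⟩
  obtain ⟨k, hk, f, hf, rfl⟩ := Set.mem_mul.1 (hF hx)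
  rw [Finset.coe_smul_finset]
  exact Set.mem_mul.2 ⟨_, Subgroup.mem_map_of_mem _ hk, g • f, Set.smul_mem_smul_set hf,
    by simp [mul_assoc]⟩

lemma isHFinite_smul_iff (g : G) :
    IsHFinite (H.map (MulAut.conj g).toMonoidHom) (g • W) ↔ IsHFinite H W := by
  refine ⟨fun h => ?_, fun h => h.smul g⟩
  convert h.smul g⁻¹
  · ext x
    simp [Subgroup.mem_map, mul_assoc]
  · simp

lemma isHAlmostEqual_refl : IsHAlmostEqual H X X := by
  simpa [IsHAlmostEqual] using isHFinite_empty

lemma IsHAlmostEqual.symm (h : IsHAlmostEqual H X Y) : IsHAlmostEqual H Y X := by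
  rwa [IsHAlmostEqual, symmDiff_comm]

lemma IsHAlmostEqual.trans (h : IsHAlmostEqual H X Y) (h' : IsHAlmostEqual H Y Z) :
    IsHAlmostEqual H X Z :=
  (IsHFinite.union h h').mono (symmDiff_triangle X Y Z)

lemma IsHAlmostEqual.compl (h : IsHAlmostEqual H X Y) : IsHAlmostEqual H Xᶜ Yᶜ := by
  rwa [IsHAlmostEqual, compl_symmDiff_compl]

lemma IsHAlmostEqual.smul (h : IsHAlmostEqual H X Y) (g : G) :
    IsHAlmostEqual (H.map (MulAut.conj g).toMonoidHom) (g • X) (g • Y) := by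
  rw [IsHAlmostEqual, ← Set.smul_set_symmDiff]
  exact IsHFinite.smul h g

end HFinite

section Boundary

variable {G : Type*} [Group G] {H : Subgroup G} {S V X Y : Set G} {g x s : G}

/-- The boundary of `V` in the Cayley graph of `G` with edges from `x` to `x * s`, `s ∈ S`,
recorded as the set of initial points of those edges that join `V` to its complement. -/
def boundary (S V : Set G) : Set G := {x | ∃ s ∈ S, ¬(x * s ∈ V ↔ x ∈ V)}

lemma mul_mem_iff_of_notMem_boundary (hx : x ∉ boundary S V) (hs : s ∈ S) :
    x * s ∈ V ↔ x ∈ V :=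
  not_not.1 fun h => hx ⟨s, hs, h⟩

lemma boundary_eq_biUnion (S V : Set G) : boundary S V = ⋃ s ∈ S, boundary {s} V := by
  ext x
  simp [boundary]

lemma boundary_compl (S V : Set G) : boundary S Vᶜ = boundary S V := by
  simp only [boundary, Set.mem_compl_iff, not_iff_not]

lemma boundary_side (S V : Set G) (b : Bool) : boundary S (side V b) = boundary S V := by
  cases b
  exacts [boundary_compl S V, rfl]

lemma boundary_smul (S V : Set G) (g : G) : boundary S (g • V) = g • boundary S V := by
  ext x
  simp only [boundary, Set.mem_ofPred_eq, Set.mem_smul_set_iff_inv_smul_mem, smul_eq_mul,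
    mul_assoc]

lemma smul_boundary_of_mem_stabilizer (hg : g ∈ stabilizer G V) :
    g • boundary S V = boundary S V := by
  rw [← boundary_smul, mem_stabilizer_iff.1 hg]

lemma proj_mem_image_iff (hX : H ≤ stabilizer G X) : proj H x ∈ proj H '' X ↔ x ∈ X := by
  refine ⟨?_, Set.mem_image_of_mem _⟩
  rintro ⟨y, hy, hyx⟩
  simpa using (mem_stabilizer_set.1 (hX (proj_eq_proj_iff.1 hyx)) y).2 hy

lemma symmDiff_rightTranslate (hX : H ≤ stabilizer G X) (g : G) :
    symmDiff (rightTranslate H g '' (proj H '' X)) (proj H '' X) =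
      proj H '' boundary {g⁻¹} X := by
  have hXg : rightTranslate H g '' (proj H '' X) = proj H '' ((· * g⁻¹) ⁻¹' X) := by
    rw [← Set.image_mul_right, Set.image_image, Set.image_image]
    rfl
  have hpre : H ≤ stabilizer G ((· * g⁻¹) ⁻¹' X) := fun h hh =>
    mem_stabilizer_set.2 fun x => by
      simpa [mul_assoc] using mem_stabilizer_set.1 (hX hh) (x * g⁻¹)
  have hbdry : H ≤ stabilizer G (boundary {g⁻¹} X) := fun h hh =>
    smul_boundary_of_mem_stabilizer (hX hh)
  ext q
  obtain ⟨x, rfl⟩ : ∃ x, proj H x = q := Quotient.exists_rep q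
  rw [hXg, Set.mem_symmDiff, proj_mem_image_iff hpre, proj_mem_image_iff hX,
    proj_mem_image_iff hbdry]
  simp only [boundary, Set.mem_preimage, Set.mem_singleton_iff, exists_eq_left, Set.mem_ofPred_eq]
  tauto

lemma isAlmostInvariant_iff : IsAlmostInvariant H X ↔
    H ≤ stabilizer G X ∧ ∀ g, IsHFinite H (boundary {g} X) := by
  constructor
  · rintro ⟨hX, h⟩
    refine ⟨hX, fun g => ?_⟩
    have := h g⁻¹
    rwa [symmDiff_rightTranslate hX, ← isHFinite_iff_finite_image_proj, inv_inv] at this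
  · rintro ⟨hX, h⟩
    refine ⟨hX, fun g => ?_⟩
    rw [symmDiff_rightTranslate hX, ← isHFinite_iff_finite_image_proj]
    exact h g⁻¹

lemma IsAlmostInvariant.le_stabilizer (h : IsAlmostInvariant H X) : H ≤ stabilizer G X :=
  h.left_invariant

lemma IsAlmostInvariant.isHFinite_boundary (h : IsAlmostInvariant H X) (hS : S.Finite) :
    IsHFinite H (boundary S X) := by
  rw [boundary_eq_biUnion]
  exact isHFinite_biUnion hS fun s _ => (isAlmostInvariant_iff.1 h).2 s

lemma IsAlmostInvariant.compl (h : IsAlmostInvariant H X) : IsAlmostInvariant H Xᶜ := by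
  rw [isAlmostInvariant_iff] at h ⊢
  simpa only [boundary_compl, stabilizer_compl] using h

lemma IsAlmostInvariant.smul (h : IsAlmostInvariant H X) (g : G) :
    IsAlmostInvariant (H.map (MulAut.conj g).toMonoidHom) (g • X) := by
  refine isAlmostInvariant_iff.2 ⟨?_, fun s => ?_⟩
  · rw [stabilizer_smul_eq_stabilizer_map_conj]
    exact Subgroup.map_mono h.le_stabilizer
  · rw [boundary_smul]
    exact (h.isHFinite_boundary (Set.finite_singleton s)).smul g

lemma IsAlmostInvariant.of_isHAlmostEqual (hX : IsAlmostInvariant H X)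
    (hY : H ≤ stabilizer G Y) (h : IsHAlmostEqual H X Y) : IsAlmostInvariant H Y := by
  refine isAlmostInvariant_iff.2 ⟨hY, fun g => ?_⟩
  refine (((hX.isHFinite_boundary (Set.finite_singleton g)).union h).union
    (IsHFinite.preimage_mul_right h g)).mono fun x hx => ?_
  simp only [boundary, Set.mem_union, Set.mem_ofPred_eq, Set.mem_symmDiff, Set.mem_preimage,
    Set.mem_singleton_iff, exists_eq_left] at hx ⊢
  tauto

end Boundary

lemma side_not {G : Type*} (U : Set G) (b : Bool) : side U (!b) = (side U b)ᶜ := by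
  cases b <;> simp [side]

section Nontrivial

variable {G : Type*} [Group G] {H L : Subgroup G} {P U V W X Y Z : Set G}

lemma isNontrivialAlmostInvariant_iff : IsNontrivialAlmostInvariant H X ↔
    IsAlmostInvariant H X ∧ ¬ IsHFinite H X ∧ ¬ IsHFinite H Xᶜ := by
  simp only [isHFinite_iff_finite_image_proj]
  exact ⟨fun h => ⟨h.1, h.2, h.3⟩, fun h => ⟨h.1, h.2.1, h.2.2⟩⟩

namespace IsNontrivialAlmostInvariant

lemma not_isHFinite (h : IsNontrivialAlmostInvariant H X) : ¬ IsHFinite H X :=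
  (isNontrivialAlmostInvariant_iff.1 h).2.1

lemma not_isHFinite_compl (h : IsNontrivialAlmostInvariant H X) : ¬ IsHFinite H Xᶜ :=
  (isNontrivialAlmostInvariant_iff.1 h).2.2

lemma compl (h : IsNontrivialAlmostInvariant H X) : IsNontrivialAlmostInvariant H Xᶜ :=
  isNontrivialAlmostInvariant_iff.2
    ⟨h.toIsAlmostInvariant.compl, h.not_isHFinite_compl, by simpa using h.not_isHFinite⟩

lemma side (h : IsNontrivialAlmostInvariant H X) (b : Bool) :
    IsNontrivialAlmostInvariant H (side X b) := by
  cases b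
  exacts [h.compl, h]

lemma smul (h : IsNontrivialAlmostInvariant H X) (g : G) :
    IsNontrivialAlmostInvariant (H.map (MulAut.conj g).toMonoidHom) (g • X) := by
  refine isNontrivialAlmostInvariant_iff.2 ⟨h.toIsAlmostInvariant.smul g, ?_, ?_⟩
  · exact (isHFinite_smul_iff g).not.2 h.not_isHFinite
  · rw [← Set.smul_set_compl]
    exact (isHFinite_smul_iff g).not.2 h.not_isHFinite_compl

lemma nonempty (h : IsNontrivialAlmostInvariant H X) : X.Nonempty := by
  rw [Set.nonempty_iff_ne_empty]
  rintro rfl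
  exact h.not_isHFinite isHFinite_empty

lemma of_isHAlmostEqual (hX : IsNontrivialAlmostInvariant H X) (hY : H ≤ stabilizer G Y)
    (h : IsHAlmostEqual H X Y) : IsNontrivialAlmostInvariant H Y := by
  refine isNontrivialAlmostInvariant_iff.2 ⟨hX.toIsAlmostInvariant.of_isHAlmostEqual hY h,
    fun hfin => hX.not_isHFinite ((hfin.union h).mono fun x hx => ?_),
    fun hfin => hX.not_isHFinite_compl ((hfin.union h.compl).mono fun x hx => ?_)⟩ <;>
  · simp only [Set.mem_union, Set.mem_symmDiff]
    tauto

end IsNontrivialAlmostInvariant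

/-- Some coset `H * p` in `P` is disjoint from `V`. Right translation by `f⁻¹ * p` moves a coset
`H * f` to it, so the part of `H * f` in `V` lies in the boundary of `V`. -/
lemma IsHFinite.inter_of_isAlmostInvariant (hZ : IsHFinite H Z) (hV : IsAlmostInvariant L V)
    (hP : H ≤ stabilizer G P) (hP' : ¬ IsHFinite H P) (hVP : IsHFinite H (V ∩ P)) :
    IsHFinite L (V ∩ Z) := by
  obtain ⟨F, hF⟩ := hZ
  obtain ⟨F', hF'⟩ := hVP
  obtain ⟨p, hp, hpF⟩ : ∃ p ∈ P, p ∉ (H : Set G) * (F' : Set G) := by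
    by_contra! hcon
    exact hP' ⟨F', hcon⟩
  have hHp : ∀ h ∈ H, h * p ∉ V := fun h hh hmem => by
    obtain ⟨k, hk, f', hf', hkf⟩ :=
      Set.mem_mul.1 (hF' ⟨hmem, (mem_stabilizer_set.1 (hP hh) p).2 hp⟩)
    exact hpF (Set.mem_mul.2 ⟨h⁻¹ * k, mul_mem (inv_mem hh) hk, f', hf', by
      rw [mul_assoc, hkf, inv_mul_cancel_left]⟩)
  refine (hV.isHFinite_boundary (F.finite_toSet.image (·⁻¹ * p))).mono ?_
  rintro x ⟨hxV, hxZ⟩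
  obtain ⟨h, hh, f, hf, rfl⟩ := Set.mem_mul.1 (hF hxZ)
  refine ⟨f⁻¹ * p, Set.mem_image_of_mem _ hf, fun hiff => hHp h hh ?_⟩
  simpa [mul_assoc] using hiff.2 hxV

lemma IsHFinite.inter_comm (hU : IsNontrivialAlmostInvariant H U) (hV : IsAlmostInvariant L V)
    (h : IsHFinite H (U ∩ V)) : IsHFinite L (V ∩ U) := by
  rw [Set.inter_comm] at h
  exact (h.inter_of_isAlmostInvariant hV hU.le_stabilizer hU.not_isHFinite h).mono
    (Set.subset_inter Set.inter_subset_left subset_rfl)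

lemma IsHFinite.of_isHAlmostEqual (hU : IsNontrivialAlmostInvariant H U)
    (hV : IsAlmostInvariant L V) (h : IsHAlmostEqual H U V) (hW : IsHFinite H W) :
    IsHFinite L W := by
  have hVW : IsHFinite L (V ∩ W) :=
    hW.inter_of_isAlmostInvariant hV hU.compl.le_stabilizer hU.compl.not_isHFinite
      (h.mono fun _ hx => Or.inr hx)
  have hVcW : IsHFinite L (Vᶜ ∩ W) :=
    hW.inter_of_isAlmostInvariant hV.compl hU.le_stabilizer hU.not_isHFinite
      (h.mono fun _ hx => Or.inl hx.symm)
  refine (hVW.union hVcW).mono ?_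
  rw [← Set.union_inter_distrib_right, Set.union_compl_self, Set.univ_inter]

/-- `U` is a nontrivial almost invariant set over some subgroup, equivalently over its stabilizer,
which serves as the canonical choice of that subgroup. -/
def IsNontrivial (U : Set G) : Prop := IsNontrivialAlmostInvariant (stabilizer G U) U

/-- `U` and `V` are almost equal over the stabilizer of `U`. Between nontrivial almost invariant
sets this is the equivalence of the paper. -/
def AlmostEq (U V : Set G) : Prop := IsHAlmostEqual (stabilizer G U) U V

namespace IsNontrivialAlmostInvariant

lemma isHFinite_stabilizer (hU : IsNontrivialAlmostInvariant H U) :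
    IsHFinite H (stabilizer G U : Set G) := by
  obtain ⟨x, hx⟩ := hU.nonempty
  obtain ⟨z, hz⟩ := hU.compl.nonempty
  have hfin := hU.isHFinite_boundary (Set.finite_singleton (x⁻¹ * z))
  refine (hfin.preimage_mul_right x).mono fun k hk => ⟨x⁻¹ * z, rfl, ?_⟩
  have hkx : k * x ∈ U := (mem_stabilizer_set.1 hk x).2 hx
  have hkz : k * z ∉ U := (mem_stabilizer_set.1 hk z).not.2 hz
  simpa [mul_assoc, hkz] using hkx

lemma isHFinite_stabilizer_iff (hU : IsNontrivialAlmostInvariant H U) :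
    IsHFinite (stabilizer G U) W ↔ IsHFinite H W :=
  ⟨hU.isHFinite_stabilizer.trans, fun hW => hW.of_le hU.le_stabilizer⟩

lemma isNontrivial (hU : IsNontrivialAlmostInvariant H U) : IsNontrivial U := by
  refine isNontrivialAlmostInvariant_iff.2 ⟨isAlmostInvariant_iff.2 ⟨le_rfl, fun g => ?_⟩, ?_⟩
  · exact hU.isHFinite_stabilizer_iff.2 (hU.isHFinite_boundary (Set.finite_singleton g))
  · simpa only [hU.isHFinite_stabilizer_iff] using ⟨hU.not_isHFinite, hU.not_isHFinite_compl⟩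

end IsNontrivialAlmostInvariant

lemma IsNontrivial.compl (hU : IsNontrivial U) : IsNontrivial Uᶜ :=
  (IsNontrivialAlmostInvariant.compl hU).isNontrivial

lemma IsNontrivial.side (hU : IsNontrivial U) (b : Bool) : IsNontrivial (side U b) :=
  (IsNontrivialAlmostInvariant.side hU b).isNontrivial

lemma IsNontrivial.smul (hU : IsNontrivial U) (g : G) : IsNontrivial (g • U) :=
  (IsNontrivialAlmostInvariant.smul hU g).isNontrivial

lemma AlmostEq.isHFinite_iff (hU : IsNontrivial U) (hV : IsNontrivial V)
    (h : AlmostEq U V) : IsHFinite (stabilizer G U) W ↔ IsHFinite (stabilizer G V) W := by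
  have hUV {Z : Set G} : IsHFinite (stabilizer G U) Z → IsHFinite (stabilizer G V) Z :=
    IsHFinite.of_isHAlmostEqual hU hV.toIsAlmostInvariant h
  exact ⟨hUV, IsHFinite.of_isHAlmostEqual hV hU.toIsAlmostInvariant (IsHAlmostEqual.symm (hUV h))⟩

lemma AlmostEq.symm (hU : IsNontrivial U) (hV : IsNontrivial V) (h : AlmostEq U V) :
    AlmostEq V U :=
  IsHAlmostEqual.symm ((h.isHFinite_iff hU hV).1 h)

lemma AlmostEq.trans (hU : IsNontrivial U) (hV : IsNontrivial V) (h : AlmostEq U V)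
    (h' : AlmostEq V W) : AlmostEq U W :=
  IsHAlmostEqual.trans h ((h.isHFinite_iff hU hV).2 h')

lemma AlmostEq.compl (h : AlmostEq U V) : AlmostEq Uᶜ Vᶜ := by
  rw [AlmostEq, stabilizer_compl]
  exact IsHAlmostEqual.compl h

lemma AlmostEq.side (h : AlmostEq U V) (b : Bool) : AlmostEq (side U b) (side V b) := by
  cases b
  exacts [h.compl, h]

lemma AlmostEq.smul (h : AlmostEq U V) (g : G) : AlmostEq (g • U) (g • V) := by
  rw [AlmostEq, stabilizer_smul_eq_stabilizer_map_conj]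
  exact IsHAlmostEqual.smul h g

end Nontrivial

section Smallness

variable {G : Type*} [Group G] {U V V' W : Set G}

lemma isSmall_iff (hU : IsNontrivial U) : IsSmall U V ↔ IsHFinite (stabilizer G U) (U ∩ V) :=
  ⟨fun ⟨_, hH, h⟩ => hH.isHFinite_stabilizer_iff.2 h, fun h => ⟨_, hU, h⟩⟩

lemma isSmall_comm (hU : IsNontrivial U) (hV : IsNontrivial V) : IsSmall U V ↔ IsSmall V U := by
  rw [isSmall_iff hU, isSmall_iff hV]
  exact ⟨IsHFinite.inter_comm hU hV.toIsAlmostInvariant,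
    IsHFinite.inter_comm hV hU.toIsAlmostInvariant⟩

lemma isSmall_of_inter_eq_empty (hU : IsNontrivial U) (h : U ∩ V = ∅) : IsSmall U V := by
  rw [isSmall_iff hU, h]
  exact isHFinite_empty

lemma IsSmall.mono_right (h : IsSmall U V) (hV : V' ⊆ V) : IsSmall U V' :=
  h.imp fun _ ⟨hU, hUV⟩ => ⟨hU, hUV.mono (Set.inter_subset_inter_right _ hV)⟩

lemma IsSmall.not_isSmall_compl (hU : IsNontrivial U) (h : IsSmall U V) : ¬ IsSmall U Vᶜ := by
  rw [isSmall_iff hU] at h ⊢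
  intro h'
  refine hU.not_isHFinite ((h.union h').mono ?_)
  rw [Set.inter_union_compl]

lemma isSmall_compl_trans (hU : IsNontrivial U) (hV : IsNontrivial V)
    (h : IsSmall U Vᶜ) (h' : IsSmall V Wᶜ) : IsSmall U Wᶜ := by
  have hUV : IsHFinite (stabilizer G V) (U ∩ Vᶜ) := by
    have := (isSmall_iff hV.compl).1 ((isSmall_comm hU hV.compl).1 h)
    rwa [stabilizer_compl, Set.inter_comm] at this
  rw [isSmall_iff hU] at h ⊢
  rw [isSmall_iff hV] at h'
  have hUVW : IsHFinite (stabilizer G U) (U ∩ (V ∩ Wᶜ)) :=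
    h'.inter_of_isAlmostInvariant hU.toIsAlmostInvariant (stabilizer_compl (G := G) (s := V)).ge
      hV.not_isHFinite_compl hUV
  refine (h.union hUVW).mono fun x hx => ?_
  by_cases hxV : x ∈ V
  exacts [Or.inr ⟨hx.1, hxV, hx.2⟩, Or.inl ⟨hx.1, hxV⟩]

lemma AlmostEq.of_isSmall (hU : IsNontrivial U) (h : IsSmall U Vᶜ) (h' : IsSmall Uᶜ V) :
    AlmostEq U V := by
  rw [isSmall_iff hU] at h
  rw [isSmall_iff hU.compl, stabilizer_compl] at h'
  exact (h.union h').mono fun x hx => hx.imp id And.symm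

/-- The corner opposite to that of index `c`. -/
def opposite (c : Bool × Bool) : Bool × Bool := (!c.1, !c.2)

lemma cornerSmall_swap (hU : IsNontrivial U) (hV : IsNontrivial V) {c : Bool × Bool} :
    CornerSmall U V c ↔ CornerSmall V U c.swap :=
  isSmall_comm (hU.side c.1) (hV.side c.2)

lemma CornerSmall.eq_of_fst_eq (hU : IsNontrivial U) {c d : Bool × Bool}
    (hc : CornerSmall U V c) (hd : CornerSmall U V d) (hcd : c.1 = d.1) : c = d := by
  refine Prod.ext hcd (by_contra fun hne => ?_)
  refine IsSmall.not_isSmall_compl (hU.side c.1) hc ?_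
  rwa [← side_not, ← Bool.eq_not.2 (Ne.symm hne), hcd]

lemma CornerSmall.eq_opposite (hU : IsNontrivial U) (hV : IsNontrivial V) {c d : Bool × Bool}
    (hc : CornerSmall U V c) (hd : CornerSmall U V d) (hcd : c ≠ d) : d = opposite c := by
  have hfst : c.1 ≠ d.1 := fun h => hcd (hc.eq_of_fst_eq hU hd h)
  have hsnd : c.2 ≠ d.2 := fun h => hcd <| Prod.swap_injective <|
    ((cornerSmall_swap hU hV).1 hc).eq_of_fst_eq hV ((cornerSmall_swap hU hV).1 hd) h
  exact Prod.ext (Bool.eq_not.2 hfst.symm) (Bool.eq_not.2 hsnd.symm)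

lemma almostLE_iff (hU : IsNontrivial U) (hV : IsNontrivial V) :
    AlmostLE U V ↔ IsSmall U Vᶜ ∧ (IsSmall Uᶜ V → U ⊆ V) := by
  constructor
  · rintro (h | h)
    · exact ⟨isSmall_of_inter_eq_empty hU h, fun _ => Set.sdiff_eq_empty.1 h⟩
    · exact ⟨(h (true, false)).2 rfl, fun h' => absurd ((h (false, true)).1 h') (by decide)⟩
  · rintro ⟨hsmall, hsub⟩
    by_cases hUV : U ⊆ V
    · exact Or.inl (Set.sdiff_eq_empty.2 hUV)
    refine Or.inr fun c => ⟨fun hc => by_contra fun hne => hUV (hsub ?_), fun hc => hc ▸ hsmall⟩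
    obtain rfl := CornerSmall.eq_opposite hU hV (c := (true, false)) hsmall hc (Ne.symm hne)
    exact hc

lemma almostLE_refl (U : Set G) : AlmostLE U U := Or.inl (Set.inter_compl_self U)

lemma AlmostLE.antisymm (hU : IsNontrivial U) (hV : IsNontrivial V) (h : AlmostLE U V)
    (h' : AlmostLE V U) : U = V := by
  rw [almostLE_iff hU hV] at h
  rw [almostLE_iff hV hU] at h'
  exact (h.2 ((isSmall_comm hU.compl hV).2 h'.1)).antisymm
    (h'.2 ((isSmall_comm hV.compl hU).2 h.1))

lemma AlmostLE.trans (hU : IsNontrivial U) (hV : IsNontrivial V) (hW : IsNontrivial W)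
    (hnest : AlmostEq U W → U ⊆ W ∨ W ⊆ U) (hUV : AlmostLE U V) (hVW : AlmostLE V W) :
    AlmostLE U W := by
  rw [almostLE_iff hU hV] at hUV
  rw [almostLE_iff hV hW] at hVW
  have hUW : IsSmall U Wᶜ := isSmall_compl_trans hU hV hUV.1 hVW.1
  refine (almostLE_iff hU hW).2 ⟨hUW, fun hWU => ?_⟩
  refine (hnest (.of_isSmall hU hUW hWU)).elim id fun hsub => ?_
  have hVU : IsSmall Uᶜ V :=
    (isSmall_comm hU.compl hV).2 (hVW.1.mono_right (Set.compl_subset_compl.2 hsub))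
  have hWV : IsSmall Vᶜ W := ((isSmall_comm hU hV.compl).1 hUV.1).mono_right hsub
  exact (hUV.2 hVU).trans (hVW.2 hWV)

lemma exists_corner_eq_empty_of_nested_sides (hU : IsNontrivial U) (hV : IsNontrivial V)
    (hnest : ∀ a b, AlmostEq (side U a) (side V b) → side U a ⊆ side V b ∨ side V b ⊆ side U a)
    {c d : Bool × Bool} (hcd : c ≠ d) (hc : CornerSmall U V c) (hd : CornerSmall U V d) :
    ∃ e, corner U V e = ∅ := by
  obtain rfl := hc.eq_opposite hU hV hd hcd
  have heq : AlmostEq (side U c.1) (side V !c.2) := by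
    refine .of_isSmall (hU.side _) ?_ ?_
    · rwa [← side_not, Bool.not_not]
    · rwa [← side_not]
  rcases hnest _ _ heq with h | h
  · refine ⟨c, Set.disjoint_iff_inter_eq_empty.1 (Set.subset_compl_iff_disjoint_right.1 ?_)⟩
    rwa [← side_not]
  · refine ⟨opposite c, Set.disjoint_iff_inter_eq_empty.1 (Set.subset_compl_iff_disjoint_left.1 ?_)⟩
    rwa [opposite, side_not U, compl_compl]

end Smallness

section StepConnected

variable {G : Type*} [Group G] {S A B C M N U V : Set G} {p x y : G}

/-- `B` is connected in the Cayley graph of `S`, in terms of cuts: a set whose boundary misses `B`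
does not separate two points of `B`. -/
def IsStepConnected (S B : Set G) : Prop :=
  ∀ V, Disjoint B (boundary S V) → ∀ x ∈ B, ∀ y ∈ B, x ∈ V ↔ y ∈ V

lemma isStepConnected_iff_of_mem (hp : p ∈ B) : IsStepConnected S B ↔
    ∀ V, Disjoint B (boundary S V) → ∀ x ∈ B, x ∈ V ↔ p ∈ V :=
  ⟨fun h V hV x hx => h V hV x hx p hp,
    fun h V hV x hx y hy => (h V hV x hx).trans (h V hV y hy).symm⟩

lemma isStepConnected_singleton (S : Set G) (x : G) : IsStepConnected S {x} :=
  (isStepConnected_iff_of_mem (Set.mem_singleton x)).2 fun _ _ y hy => by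
    rw [Set.mem_singleton_iff.1 hy]

namespace IsStepConnected

lemma union (hB : IsStepConnected S B) (hC : IsStepConnected S C) (hpB : p ∈ B) (hpC : p ∈ C) :
    IsStepConnected S (B ∪ C) :=
  (isStepConnected_iff_of_mem (Set.mem_union_left C hpB)).2 fun V hV x hx =>
    hx.elim (fun hx => hB V (hV.mono_left Set.subset_union_left) x hx p hpB)
      (fun hx => hC V (hV.mono_left Set.subset_union_right) x hx p hpC)

lemma insert_of_adjacent (hB : IsStepConnected S B) (hy : y ∈ B)
    (h : ∃ s ∈ S, y * s = x ∨ x * s = y) : IsStepConnected S (insert x B) := by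
  refine (isStepConnected_iff_of_mem (Set.mem_insert_of_mem x hy)).2 fun V hV z hz => ?_
  rw [Set.disjoint_insert_left] at hV
  rcases hz with rfl | hz
  · obtain ⟨s, hs, rfl | rfl⟩ := h
    · exact mul_mem_iff_of_notMem_boundary (Set.disjoint_left.1 hV.2 hy) hs
    · exact (mul_mem_iff_of_notMem_boundary hV.1 hs).symm
  · exact hB V hV.2 z hz y hy

lemma smul (hB : IsStepConnected S B) (g : G) : IsStepConnected S (g • B) := by
  rintro V hV _ ⟨x, hx, rfl⟩ _ ⟨y, hy, rfl⟩
  rw [Set.disjoint_smul_set_left, ← boundary_smul] at hV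
  simpa [Set.mem_inv_smul_set_iff] using hB _ hV x hx y hy

lemma closure_mul (hB : IsStepConnected S B) (h1 : 1 ∈ B) (hA : A ⊆ B) :
    IsStepConnected S ((Subgroup.closure A : Set G) * B) := by
  have hmem : (1 : G) ∈ (Subgroup.closure A : Set G) * B := ⟨1, one_mem _, 1, h1, one_mul 1⟩
  refine (isStepConnected_iff_of_mem hmem).2 fun V hV => ?_
  have htranslate {k : G} (hk : k ∈ Subgroup.closure A) {b : G} (hb : b ∈ B) :
      k * b ∈ V ↔ k ∈ V := by
    refine (hB.smul k) V (hV.mono_left ?_) _ (Set.smul_mem_smul_set hb) _ ⟨1, h1, mul_one k⟩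
    exact Set.smul_set_subset_mul hk
  have hclosure {k : G} (hk : k ∈ Subgroup.closure A) : k ∈ V ↔ 1 ∈ V := by
    induction hk using Subgroup.closure_induction_right with
    | one => rfl
    | mul_right k hk a ha ih => exact (htranslate hk (hA ha)).trans ih
    | mul_inv_cancel k hk a ha ih =>
      have ha' := inv_mem (Subgroup.subset_closure ha)
      rw [← ih, ← htranslate (mul_mem hk ha') (hA ha), inv_mul_cancel_right]
  rintro _ ⟨k, hk, b, hb, rfl⟩
  exact (htranslate hk hb).trans (hclosure hk)

lemma exists_subset_side (hB : IsStepConnected S B) (h : Disjoint B (boundary S V)) :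
    ∃ b, B ⊆ side V b := by
  by_cases hBV : B ⊆ V
  · exact ⟨true, hBV⟩
  · obtain ⟨x, hx, hxV⟩ := Set.not_subset.1 hBV
    exact ⟨false, fun y hy hyV => hxV ((hB V h x hx y hy).2 hyV)⟩

end IsStepConnected

lemma exists_finset_isStepConnected (hS : Subgroup.closure S = ⊤) (F : Finset G) :
    ∃ B : Finset G, F ⊆ B ∧ 1 ∈ B ∧ IsStepConnected S B := by
  classical
  have hpoint (g : G) : ∃ B : Finset G, g ∈ B ∧ 1 ∈ B ∧ IsStepConnected S B := by
    have hg : g ∈ Subgroup.closure S := hS ▸ Subgroup.mem_top g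
    induction hg using Subgroup.closure_induction_right with
    | one => exact ⟨{1}, by simp, by simp, by simpa using isStepConnected_singleton S 1⟩
    | mul_right k _ s hs ih =>
      obtain ⟨B, hk, h1, hB⟩ := ih
      refine ⟨insert (k * s) B, by simp, by simp [h1], ?_⟩
      rw [Finset.coe_insert]
      exact hB.insert_of_adjacent hk ⟨s, hs, Or.inl rfl⟩
    | mul_inv_cancel k _ s hs ih =>
      obtain ⟨B, hk, h1, hB⟩ := ih
      refine ⟨insert (k * s⁻¹) B, by simp, by simp [h1], ?_⟩
      rw [Finset.coe_insert]
      exact hB.insert_of_adjacent hk ⟨s, hs, Or.inr (inv_mul_cancel_right k s)⟩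
  induction F using Finset.induction_on with
  | empty => exact ⟨{1}, by simp, by simp, by simpa using isStepConnected_singleton S 1⟩
  | insert g F _ ih =>
    obtain ⟨B, hFB, h1B, hB⟩ := ih
    obtain ⟨C, hgC, h1C, hC⟩ := hpoint g
    refine ⟨B ∪ C, Finset.insert_subset (by simp [hgC]) (hFB.trans Finset.subset_union_left),
      by simp [h1B], ?_⟩
    rw [Finset.coe_union]
    exact hB.union hC h1B h1C

lemma eq_empty_or_eq_univ_of_boundary_eq_empty (hS : Subgroup.closure S = ⊤)
    (h : boundary S V = ∅) : V = ∅ ∨ V = Set.univ := by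
  have hmem (x : G) : x ∈ V ↔ 1 ∈ V := by
    obtain ⟨B, hxB, h1B, hB⟩ := exists_finset_isStepConnected hS {x}
    exact hB V (by simp [h]) x (by simpa using hxB) 1 h1B
  by_cases h1 : 1 ∈ V
  · exact Or.inr (Set.eq_univ_of_forall fun x => (hmem x).2 h1)
  · exact Or.inl (Set.eq_empty_of_forall_notMem fun x hx => h1 ((hmem x).1 hx))

lemma IsAlmostInvariant.exists_isStepConnected_mul {H : Subgroup G} (hV : IsAlmostInvariant H V)
    (hH : H.FG) (hfin : S.Finite) (hS : Subgroup.closure S = ⊤) :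
    ∃ B : Finset G, boundary S V ⊆ (H : Set G) * B ∧ IsStepConnected S ((H : Set G) * B) := by
  classical
  obtain ⟨F, hF⟩ := hV.isHFinite_boundary hfin
  obtain ⟨A, rfl⟩ := hH
  obtain ⟨B, hFB, h1, hB⟩ := exists_finset_isStepConnected hS (F ∪ A)
  obtain ⟨hFB, hAB⟩ := Finset.union_subset_iff.1 hFB
  exact ⟨B, hF.trans (Set.mul_subset_mul_left (Finset.coe_subset.2 hFB)),
    hB.closure_mul h1 (Finset.coe_subset.2 hAB)⟩

lemma boundary_inter_eq_empty (hUV : Disjoint (boundary S U) V) (hVU : Disjoint (boundary S V) U)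
    (h : Disjoint (boundary S U) (boundary S V)) : boundary S (U ∩ V) = ∅ := by
  refine Set.eq_empty_of_forall_notMem fun x ⟨s, hs, hx⟩ => hx ?_
  by_cases hxU : x ∈ boundary S U
  · have hxV : x ∉ V := Set.disjoint_left.1 hUV hxU
    have hxsV := mul_mem_iff_of_notMem_boundary (Set.disjoint_left.1 h hxU) hs
    simp [hxV, hxsV]
  · have hxsU := mul_mem_iff_of_notMem_boundary hxU hs
    by_cases hxV : x ∈ boundary S V
    · simp [hxsU, Set.disjoint_left.1 hVU hxV]
    · simp [hxsU, mul_mem_iff_of_notMem_boundary hxV hs]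

lemma exists_corner_eq_empty_of_disjoint (hS : Subgroup.closure S = ⊤)
    (hM : IsStepConnected S M) (hN : IsStepConnected S N) (hMN : Disjoint M N)
    (hUM : boundary S U ⊆ M) (hVN : boundary S V ⊆ N) (hU : U.Nonempty) (hUc : Uᶜ.Nonempty) :
    ∃ e, corner U V e = ∅ := by
  obtain ⟨a, ha⟩ := hM.exists_subset_side (hMN.mono_right hVN)
  obtain ⟨b, hb⟩ := hN.exists_subset_side (hMN.symm.mono_right hUM)
  refine ⟨(!b, !a), (eq_empty_or_eq_univ_of_boundary_eq_empty hS ?_).resolve_right fun h => ?_⟩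
  · apply boundary_inter_eq_empty <;> simp only [side_not, boundary_compl, boundary_side]
    · exact Set.disjoint_compl_right_iff_subset.2 (hUM.trans ha)
    · exact Set.disjoint_compl_right_iff_subset.2 (hVN.trans hb)
    · exact hMN.mono hUM hVN
  · have huniv : side U (!b) = Set.univ :=
      Set.univ_subset_iff.1 (h.symm.trans_subset Set.inter_subset_left)
    cases b
    · exact hUc.ne_empty (Set.compl_empty_iff.2 huniv)
    · exact hU.ne_empty (Set.compl_univ_iff.1 huniv)

end StepConnected

section Crossing

variable {G : Type*} [Group G] {H L : Subgroup G} {U V : Set G}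

lemma AlmostEq.subset_or_subset_of_corner_eq_empty (hU : IsNontrivial U) (h : AlmostEq U V)
    {e : Bool × Bool} (he : corner U V e = ∅) : U ⊆ V ∨ V ⊆ U := by
  rw [corner, ← Set.disjoint_iff_inter_eq_empty] at he
  match e, he with
  | (true, true), he =>
    exact absurd (h.mono fun x hx => Or.inl ⟨hx, Set.disjoint_left.1 he hx⟩) hU.not_isHFinite
  | (true, false), he => exact Or.inl (Set.disjoint_compl_right_iff_subset.1 he)
  | (false, true), he => exact Or.inr (Set.disjoint_compl_left_iff_subset.1 he)
  | (false, false), he =>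
    have hUV : Uᶜ ⊆ V := Set.disjoint_compl_right_iff_subset.1 he
    exact absurd (h.mono fun x hx => Or.inr ⟨hUV hx, hx⟩) hU.not_isHFinite_compl

lemma IsHFinite.finite_image_inv_smul {K : Set G} (hK : IsHFinite (stabilizer G V) K) :
    ((fun k => k⁻¹ • V) '' K).Finite := by
  obtain ⟨F, hF⟩ := hK
  refine (F.finite_toSet.image fun k => k⁻¹ • V).subset ?_
  rintro _ ⟨k, hk, rfl⟩
  obtain ⟨h, hh, f, hf, rfl⟩ := Set.mem_mul.1 (hF hk)
  exact ⟨f, hf, by simp only [mul_inv_rev, mul_smul, mem_stabilizer_iff.1 (inv_mem hh)]⟩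

lemma IsNontrivial.finite_setOf_separates (hV : IsNontrivial V) (x y : G) :
    {U ∈ orbit G V | ¬(x ∈ U ↔ y ∈ U)}.Finite := by
  have hK := (hV.isHFinite_boundary (Set.finite_singleton (x⁻¹ * y))).preimage_mul_right x
  refine hK.finite_image_inv_smul.subset ?_
  rintro _ ⟨⟨g, rfl⟩, hxy⟩
  refine ⟨g⁻¹, ⟨x⁻¹ * y, rfl, fun h => hxy ?_⟩, by simp only [inv_inv]⟩
  simpa [Set.mem_smul_set_iff_inv_smul_mem, mul_assoc] using h.symm

lemma AlmostEq.finite_image_smul (hU : IsNontrivialAlmostInvariant H U) (hV : IsNontrivial V)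
    (h : AlmostEq U V) : ((· • V) '' (H : Set G)).Finite := by
  have hH : IsHFinite (stabilizer G U) (H : Set G) :=
    (isHFinite_self (stabilizer G U)).mono hU.le_stabilizer
  refine ((h.isHFinite_iff hU.isNontrivial hV).1 hH).finite_image_inv_smul.subset ?_
  rintro _ ⟨k, hk, rfl⟩
  exact ⟨k⁻¹, inv_mem hk, by simp only [inv_inv]⟩

lemma exists_smul_eq_of_not_disjoint {B C : Set G} {g : G} (hL : L ≤ stabilizer G V)
    (h : ¬ Disjoint ((H : Set G) * B) (g • ((L : Set G) * C))) :
    ∃ k ∈ H, ∃ d ∈ B * C⁻¹, g • V = k • d • V := by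
  obtain ⟨_, ⟨k, hk, b, hb, rfl⟩, _, ⟨l, hl, c, hc, rfl⟩, heq⟩ := Set.not_disjoint_iff.1 h
  refine ⟨k, hk, b * c⁻¹, Set.mul_mem_mul hb (Set.inv_mem_inv.2 hc), ?_⟩
  have hg : g * l = k * (b * c⁻¹) := by
    rw [← mul_assoc, eq_mul_inv_iff_mul_eq, mul_assoc]
    exact heq
  rw [← mul_smul, ← hg, mul_smul, mem_stabilizer_iff.1 (hL hl)]

lemma finite_setOf_almostEq_not_nested [Group.FG G] (hH : H.FG) (hL : L.FG)
    (hU : IsNontrivialAlmostInvariant H U) (hV : IsNontrivialAlmostInvariant L V) :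
    {W ∈ orbit G V | AlmostEq U W ∧ ¬(U ⊆ W ∨ W ⊆ U)}.Finite := by
  obtain ⟨S, hS, hfin⟩ := (Group.fg_iff (G := G)).1 inferInstance
  obtain ⟨B, hUB, hB⟩ := hU.toIsAlmostInvariant.exists_isStepConnected_mul hH hfin hS
  obtain ⟨C, hVC, hC⟩ := hV.toIsAlmostInvariant.exists_isStepConnected_mul hL hfin hS
  have hBC : ((B : Set G) * (C : Set G)⁻¹).Finite := B.finite_toSet.mul C.finite_toSet.inv
  refine ((hBC.subset (Set.sep_subset _ fun d => AlmostEq U (d • V))).biUnion fun d hd =>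
    AlmostEq.finite_image_smul hU (hV.isNontrivial.smul d) hd.2).subset ?_
  rintro W ⟨⟨g, hg⟩, heq, hnest⟩
  obtain rfl : g • V = W := hg
  have hmeet : ¬ Disjoint ((H : Set G) * B) (g • ((L : Set G) * C)) := fun hdisj => by
    obtain ⟨e, he⟩ := exists_corner_eq_empty_of_disjoint hS hB (hC.smul g) hdisj hUB
      ((boundary_smul S V g).trans_subset (Set.smul_set_mono hVC)) hU.nonempty hU.compl.nonempty
    exact hnest (heq.subset_or_subset_of_corner_eq_empty hU.isNontrivial he)
  obtain ⟨k, hk, d, hd, hgd⟩ := exists_smul_eq_of_not_disjoint hV.le_stabilizer hmeet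
  have heqd : AlmostEq U (d • V) := by
    have := heq.smul k⁻¹
    rwa [mem_stabilizer_iff.1 (hU.le_stabilizer (inv_mem hk)), hgd, inv_smul_smul] at this
  exact Set.mem_biUnion ⟨hd, heqd⟩ ⟨k, hk, hgd.symm⟩

end Crossing

section Height

variable {α G : Type*} [Group G] [MulAction G α] {T : Set (Set α)} {P Q : Set α} {x y : α}

/-- Any two points are separated by only finitely many members of `T`; this is what makes the
heights between points finite. -/
def SeparatesFinitely (T : Set (Set α)) : Prop := ∀ x y, {V ∈ T | ¬(x ∈ V ↔ y ∈ V)}.Finite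

/-- The height of `x` above `y`: the number of members of `T` that contain `x` but not `y`, minus
the number of those that contain `y` but not `x`. It is only meaningful if `T` separates
finitely, a `finsum` of infinite support being `0`. -/
noncomputable def height (T : Set (Set α)) (x y : α) : ℤ :=
  ∑ᶠ V ∈ T, (V.indicator 1 x - V.indicator 1 y)

lemma height_swap (T : Set (Set α)) (x y : α) : height T y x = -height T x y := by
  simp only [height, ← finsum_neg_distrib, neg_sub]

lemma SeparatesFinitely.mono {T' : Set (Set α)} (hT : SeparatesFinitely T) (h : T' ⊆ T) :
    SeparatesFinitely T' :=
  fun x y => (hT x y).subset fun _ hV => ⟨h hV.1, hV.2⟩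

lemma SeparatesFinitely.finite_inter_support (hT : SeparatesFinitely T) (x y : α) :
    (T ∩ Function.support fun V => (V.indicator 1 x - V.indicator 1 y : ℤ)).Finite := by
  refine (hT x y).subset fun V hV => ⟨hV.1, fun h => hV.2 ?_⟩
  by_cases hy : y ∈ V <;> simp [h, hy]

lemma SeparatesFinitely.height_add (hT : SeparatesFinitely T) (x y z : α) :
    height T x y + height T y z = height T x z := by
  rw [height, height, ← finsum_mem_add_distrib' (hT.finite_inter_support x y)
    (hT.finite_inter_support y z)]
  simp only [sub_add_sub_cancel, height]

lemma SeparatesFinitely.height_neg (hT : SeparatesFinitely T) (h : ∀ V ∈ T, x ∈ V → y ∈ V)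
    (hP : P ∈ T) (hxP : x ∉ P) (hyP : y ∈ P) : height T x y < 0 := by
  rw [height, finsum_mem_eq_sum _ (hT.finite_inter_support x y)]
  refine Finset.sum_neg' (fun V hV => ?_) ⟨P, ?_, ?_⟩
  · have hVT := ((Set.Finite.mem_toFinset _).1 hV).1
    by_cases hx : x ∈ V
    · simp [hx, h V hVT hx]
    · by_cases hy : y ∈ V <;> simp [hx, hy]
  · simp [hP, hxP, hyP]
  · simp [hxP, hyP]

lemma height_smul (T : Set (Set α)) (g : G) (x y : α) :
    height (g • T) (g • x) (g • y) = height T x y := by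
  have hmem (z : α) (V : Set α) :
      (g • V).indicator (1 : α → ℤ) (g • z) = V.indicator 1 z := by
    by_cases hz : z ∈ V <;> simp [hz]
  rw [height, ← Set.image_smul, finsum_mem_image (MulAction.injective g).injOn]
  simp only [hmem, height]

lemma height_compl (T : Set (Set α)) (x y : α) : height (compl '' T) x y = height T y x := by
  rw [height, finsum_mem_image compl_injective.injOn]
  simp only [Set.indicator_compl, Pi.sub_apply, Pi.one_apply, sub_sub_sub_cancel_left, height]

/-- `P` is upward closed for the total preorder in which `x` is above `y` if its height above `y`
is nonnegative. -/
def IsHeightUpper (T : Set (Set α)) (P : Set α) : Prop :=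
  ∀ x y, y ∈ P → 0 ≤ height T x y → x ∈ P

lemma IsHeightUpper.subset_or_subset (hP : IsHeightUpper T P) (hQ : IsHeightUpper T Q) :
    P ⊆ Q ∨ Q ⊆ P := by
  refine or_iff_not_imp_left.2 fun hPQ y hy => ?_
  obtain ⟨x, hx, hxQ⟩ := Set.not_subset.1 hPQ
  rcases le_total 0 (height T y x) with h | h
  · exact hP y x hx h
  · exact absurd (hQ x y hy (by rwa [height_swap, neg_nonneg])) hxQ

lemma IsHeightUpper.smul (hP : IsHeightUpper T P) (g : G) :
    IsHeightUpper (g • T) (g • P) := by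
  rintro x _ ⟨y, hy, rfl⟩ h
  rw [← smul_inv_smul g x, height_smul] at h
  exact Set.mem_smul_set_iff_inv_smul_mem.2 (hP _ y hy h)

lemma IsHeightUpper.compl (hP : IsHeightUpper T P) : IsHeightUpper (compl '' T) Pᶜ :=
  fun x y hy h hx => hy (hP y x hx (by rwa [height_compl] at h))

/-- The upward closure of `P` for the preorder given by the heights with respect to `T`. -/
def heightUpperClosure (T : Set (Set α)) (P : Set α) : Set α := {x | ∃ y ∈ P, 0 ≤ height T x y}

lemma subset_heightUpperClosure (T : Set (Set α)) (P : Set α) : P ⊆ heightUpperClosure T P :=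
  fun x hx => ⟨x, hx, by simp [height]⟩

lemma SeparatesFinitely.isHeightUpper_heightUpperClosure (hT : SeparatesFinitely T) (P : Set α) :
    IsHeightUpper T (heightUpperClosure T P) := by
  rintro x y ⟨z, hz, hyz⟩ hxy
  exact ⟨z, hz, (hT.height_add x y z).symm ▸ add_nonneg hxy hyz⟩

lemma smul_heightUpperClosure (g : G) (T : Set (Set α)) (P : Set α) :
    g • heightUpperClosure T P = heightUpperClosure (g • T) (g • P) := by
  ext x
  rw [Set.mem_smul_set_iff_inv_smul_mem]
  constructor
  · rintro ⟨y, hy, h⟩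
    refine ⟨g • y, Set.smul_mem_smul_set hy, ?_⟩
    rwa [← height_smul T g, smul_inv_smul] at h
  · rintro ⟨_, ⟨y, hy, rfl⟩, h⟩
    exact ⟨y, hy, by rwa [← height_smul T g, smul_inv_smul]⟩

lemma SeparatesFinitely.exists_mem_of_mem_heightUpperClosure (hT : SeparatesFinitely T)
    (hP : P ∈ T) (hx : x ∈ heightUpperClosure T P) (hxP : x ∉ P) :
    ∃ V ∈ T, ¬(P ⊆ V ∨ V ⊆ P) ∧ x ∈ V := by
  obtain ⟨y, hy, hxy⟩ := hx
  have hV : ∃ V ∈ T, x ∈ V ∧ y ∉ V := by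
    by_contra! h
    exact hxy.not_gt (hT.height_neg h hP hxP hy)
  obtain ⟨V, hV, hxV, hyV⟩ := hV
  exact ⟨V, hV, not_or.2 ⟨fun h => hyV (h hy), fun h => hxP (h hxV)⟩, hxV⟩

end Height

section Translates

variable {G : Type*} [Group G] {ι : Type*} {X : ι → Set G} {H : ι → Subgroup G} {U : Set G}

lemma mem_translates_iff : U ∈ translates X ↔ ∃ i b, U ∈ orbit G (side (X i) b) := by
  simp only [translates, Set.mem_ofPred_eq, mem_orbit_iff, Bool.exists_bool, side,
    eq_comm (a := U), ← exists_or, or_comm]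
  exact exists_comm

lemma smul_mem_translates_iff (g : G) : g • U ∈ translates X ↔ U ∈ translates X := by
  simp only [mem_translates_iff, ← orbit_eq_iff, orbit_smul]

lemma compl_mem_translates (hU : U ∈ translates X) : Uᶜ ∈ translates X := by
  obtain ⟨i, b, g, rfl⟩ := mem_translates_iff.1 hU
  exact mem_translates_iff.2 ⟨i, !b, g, by simpa only [side_not] using Set.smul_set_compl⟩

lemma compl_mem_translates_iff : Uᶜ ∈ translates X ↔ U ∈ translates X :=
  ⟨fun h => compl_compl U ▸ compl_mem_translates h, compl_mem_translates⟩

lemma side_mem_translates (hU : U ∈ translates X) (b : Bool) : side U b ∈ translates X := by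
  cases b
  exacts [compl_mem_translates hU, hU]

lemma IsNontrivial.of_mem_translates (hX : ∀ i, IsNontrivial (X i)) (hU : U ∈ translates X) :
    IsNontrivial U := by
  obtain ⟨i, b, g, rfl⟩ := mem_translates_iff.1 hU
  exact ((hX i).side b).smul g

lemma finite_setOf_mem_translates [Finite ι] {p : Set G → Prop}
    (h : ∀ i b, {U ∈ orbit G (side (X i) b) | p U}.Finite) : {U ∈ translates X | p U}.Finite := by
  refine (Set.finite_iUnion fun i => Set.finite_iUnion fun b => h i b).subset ?_
  rintro U ⟨hU, hp⟩
  obtain ⟨i, b, hU⟩ := mem_translates_iff.1 hU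
  exact Set.mem_iUnion₂.2 ⟨i, b, hU, hp⟩

lemma separatesFinitely_translates [Finite ι] (hX : ∀ i, IsNontrivial (X i)) :
    SeparatesFinitely (translates X) := fun x y =>
  finite_setOf_mem_translates fun i b => ((hX i).side b).finite_setOf_separates x y

lemma finite_setOf_mem_translates_almostEq_not_nested [Finite ι] [Group.FG G]
    (hH : ∀ i, (H i).FG) (hX : ∀ i, IsNontrivialAlmostInvariant (H i) (X i)) (i : ι) :
    {V ∈ translates X | AlmostEq (X i) V ∧ ¬(X i ⊆ V ∨ V ⊆ X i)}.Finite :=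
  finite_setOf_mem_translates fun j b =>
    finite_setOf_almostEq_not_nested (hH i) (hH j) (hX i) ((hX j).side b)

end Translates

section Straightening

variable {G : Type*} [Group G] {ι : Type*} {X : ι → Set G} {H : ι → Subgroup G} {U V W : Set G}

/-- The members of `E(X₁, …, Xₙ)` that are almost equal to `U`. -/
def almostEqClass (X : ι → Set G) (U : Set G) : Set (Set G) := {V ∈ translates X | AlmostEq U V}

lemma almostEqClass_congr (hU : IsNontrivial U) (hV : IsNontrivial V) (h : AlmostEq U V) :
    almostEqClass X U = almostEqClass X V := by
  ext W
  exact and_congr_right fun _ => ⟨(h.symm hU hV).trans hV hU, h.trans hU hV⟩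

lemma smul_almostEqClass (g : G) (X : ι → Set G) (U : Set G) :
    g • almostEqClass X U = almostEqClass X (g • U) := by
  ext V
  rw [Set.mem_smul_set_iff_inv_smul_mem]
  refine and_congr (smul_mem_translates_iff g⁻¹) ⟨fun h => ?_, fun h => ?_⟩
  · simpa using h.smul g
  · simpa using h.smul g⁻¹

lemma image_compl_almostEqClass (X : ι → Set G) (U : Set G) :
    compl '' almostEqClass X U = almostEqClass X Uᶜ := by
  ext V
  rw [Set.mem_compl_image]
  refine and_congr compl_mem_translates_iff ⟨fun h => ?_, fun h => ?_⟩
  · simpa using h.compl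
  · simpa using h.compl

lemma isHeightUpper_smul_side_almostEqClass (h : IsHeightUpper (almostEqClass X U) W) (g : G)
    (b : Bool) : IsHeightUpper (almostEqClass X (g • side U b)) (g • side W b) := by
  rw [← smul_almostEqClass]
  cases b
  · rw [side, ← image_compl_almostEqClass]
    exact h.compl.smul g
  · exact h.smul g

/-- `X i` made upward closed for the heights that count the members of `E(X₁, …, Xₙ)` almost equal
to it; these are the sets `Y i` of the theorem. -/
def straightening (X : ι → Set G) (i : ι) : Set G :=
  heightUpperClosure (almostEqClass X (X i)) (X i)

lemma stabilizer_le_stabilizer_straightening (X : ι → Set G) (i : ι) :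
    stabilizer G (X i) ≤ stabilizer G (straightening X i) := fun g hg => by
  rw [mem_stabilizer_iff] at hg ⊢
  rw [straightening, smul_heightUpperClosure, smul_almostEqClass, hg]

lemma mem_almostEqClass_self (X : ι → Set G) (i : ι) : X i ∈ almostEqClass X (X i) :=
  ⟨mem_translates_iff.2 ⟨i, true, 1, one_smul _ _⟩, isHAlmostEqual_refl⟩

lemma separatesFinitely_almostEqClass [Finite ι] (hX : ∀ i, IsNontrivial (X i)) (U : Set G) :
    SeparatesFinitely (almostEqClass X U) :=
  (separatesFinitely_translates hX).mono (Set.sep_subset _ _)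

lemma almostEq_straightening [Finite ι] [Group.FG G] (hH : ∀ i, (H i).FG)
    (hX : ∀ i, IsNontrivialAlmostInvariant (H i) (X i)) (i : ι) :
    AlmostEq (X i) (straightening X i) := by
  have hfin := isHFinite_biUnion (finite_setOf_mem_translates_almostEq_not_nested hH hX i)
    fun V hV => hV.2.1
  refine IsHFinite.mono hfin ?_
  rw [straightening, symmDiff_of_le (subset_heightUpperClosure _ _)]
  rintro x ⟨hx, hxX⟩
  obtain ⟨V, ⟨hVX, hV⟩, hnest, hxV⟩ := SeparatesFinitely.exists_mem_of_mem_heightUpperClosure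
    (separatesFinitely_almostEqClass (fun j => (hX j).isNontrivial) (X i))
    (mem_almostEqClass_self X i) hx hxX
  exact Set.mem_biUnion ⟨hVX, hV, hnest⟩ (Or.inr ⟨hxV, hxX⟩)

lemma isHAlmostEqual_straightening [Finite ι] [Group.FG G] (hH : ∀ i, (H i).FG)
    (hX : ∀ i, IsNontrivialAlmostInvariant (H i) (X i)) (i : ι) :
    IsHAlmostEqual (H i) (X i) (straightening X i) :=
  (hX i).isHFinite_stabilizer_iff.1 (almostEq_straightening hH hX i)

lemma isNontrivialAlmostInvariant_straightening [Finite ι] [Group.FG G] (hH : ∀ i, (H i).FG)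
    (hX : ∀ i, IsNontrivialAlmostInvariant (H i) (X i)) (i : ι) :
    IsNontrivialAlmostInvariant (H i) (straightening X i) :=
  (hX i).of_isHAlmostEqual
    ((hX i).le_stabilizer.trans (stabilizer_le_stabilizer_straightening X i))
    (isHAlmostEqual_straightening hH hX i)

lemma exists_isHeightUpper_of_mem_translates_straightening [Finite ι] [Group.FG G]
    (hH : ∀ i, (H i).FG) (hX : ∀ i, IsNontrivialAlmostInvariant (H i) (X i))
    (hW : W ∈ translates (straightening X)) :
    ∃ U ∈ translates X, AlmostEq U W ∧ IsHeightUpper (almostEqClass X U) W := by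
  obtain ⟨i, b, g, rfl⟩ := mem_translates_iff.1 hW
  have hupper := (separatesFinitely_almostEqClass (fun j => (hX j).isNontrivial)
    (X i)).isHeightUpper_heightUpperClosure (X i)
  exact ⟨g • side (X i) b, mem_translates_iff.2 ⟨i, b, g, rfl⟩,
    ((almostEq_straightening hH hX i).side b).smul g,
    isHeightUpper_smul_side_almostEqClass hupper g b⟩

lemma subset_or_subset_of_almostEq_of_mem_translates_straightening [Finite ι] [Group.FG G]
    (hH : ∀ i, (H i).FG) (hX : ∀ i, IsNontrivialAlmostInvariant (H i) (X i))
    (hV : V ∈ translates (straightening X)) (hW : W ∈ translates (straightening X))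
    (h : AlmostEq V W) : V ⊆ W ∨ W ⊆ V := by
  have hY (i : ι) := (isNontrivialAlmostInvariant_straightening hH hX i).isNontrivial
  have hX' (i : ι) := (hX i).isNontrivial
  have hV' := IsNontrivial.of_mem_translates hY hV
  have hW' := IsNontrivial.of_mem_translates hY hW
  obtain ⟨U, hU, hUV, hupperV⟩ := exists_isHeightUpper_of_mem_translates_straightening hH hX hV
  obtain ⟨U', hU', hUW, hupperW⟩ := exists_isHeightUpper_of_mem_translates_straightening hH hX hW
  replace hU := IsNontrivial.of_mem_translates hX' hU
  replace hU' := IsNontrivial.of_mem_translates hX' hU'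
  rw [almostEqClass_congr hU hV' hUV, almostEqClass_congr hV' hW' h] at hupperV
  rw [almostEqClass_congr hU' hW' hUW] at hupperW
  exact hupperV.subset_or_subset hupperW

end Straightening

section GoodPosition

variable {G : Type*} [Group G] {ι : Type*} {Y : ι → Set G}

lemma inGoodPosition_of_nested (hY : ∀ i, IsNontrivial (Y i))
    (hnest : ∀ U ∈ translates Y, ∀ V ∈ translates Y, AlmostEq U V → U ⊆ V ∨ V ⊆ U) :
    InGoodPosition Y := fun _ hU _ hV _ _ hcd hc hd =>
  exists_corner_eq_empty_of_nested_sides (.of_mem_translates hY hU) (.of_mem_translates hY hV)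
    (fun a b => hnest _ (side_mem_translates hU a) _ (side_mem_translates hV b)) hcd hc hd

lemma isPartialOrder_almostLE_of_nested (hY : ∀ i, IsNontrivial (Y i))
    (hnest : ∀ U ∈ translates Y, ∀ V ∈ translates Y, AlmostEq U V → U ⊆ V ∨ V ⊆ U) :
    IsPartialOrder (translates Y) (fun U V => AlmostLE (U : Set G) (V : Set G)) where
  refl _ := almostLE_refl _
  trans U V W hUV hVW :=
    hUV.trans (.of_mem_translates hY U.2) (.of_mem_translates hY V.2) (.of_mem_translates hY W.2)
      (hnest U U.2 W W.2) hVW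
  antisymm U V hUV hVU :=
    Subtype.ext (hUV.antisymm (.of_mem_translates hY U.2) (.of_mem_translates hY V.2) hVU)

end GoodPosition

end AlmostInvariant

open AlmostInvariant in
theorem mainTheorem4_general {G : Type*} [Group G] [Group.FG G] {ι : Type*} [Finite ι]
    (H : ι → Subgroup G) (hH : ∀ i, (H i).FG) (X : ι → Set G)
    (hX : ∀ i, IsNontrivialAlmostInvariant (H i) (X i)) :
    ∃ Y : ι → Set G,
      (∀ i, IsNontrivialAlmostInvariant (H i) (Y i)) ∧
      (∀ i, IsEquivalent (H i) (H i) (X i) (Y i)) ∧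
      InGoodPosition Y ∧
      IsPartialOrder (translates Y) (fun U V => AlmostLE (U : Set G) (V : Set G)) := by
  have hY := isNontrivialAlmostInvariant_straightening hH hX
  have hnest : ∀ U ∈ translates (straightening X), ∀ V ∈ translates (straightening X),
      AlmostEq U V → U ⊆ V ∨ V ⊆ U :=
    fun _ hU _ hV => subset_or_subset_of_almostEq_of_mem_translates_straightening hH hX hU hV
  refine ⟨straightening X, hY, fun i => ⟨(hX i).toIsAlmostInvariant, (hY i).toIsAlmostInvariant,
    isHAlmostEqual_straightening hH hX i⟩, ?_, ?_⟩
  · exact inGoodPosition_of_nested (fun i => (hY i).isNontrivial) hnest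
  · exact isPartialOrder_almostLE_of_nested (fun i => (hY i).isNontrivial) hnest

theorem mainTheorem4 {G : Type*} [Group G] [Group.FG G] (n : ℕ)
    (H : Fin n → Subgroup G) (hH : ∀ i, (H i).FG)
    (X : Fin n → Set G)
    (hX : ∀ i, AlmostInvariant.IsNontrivialAlmostInvariant (H i) (X i)) :
    ∃ (K : Fin n → Subgroup G) (Y : Fin n → Set G),
      (∀ i, (K i).FG) ∧
      (∀ i, AlmostInvariant.IsNontrivialAlmostInvariant (K i) (Y i)) ∧
      (∀ i, AlmostInvariant.IsEquivalent (H i) (K i) (X i) (Y i)) ∧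
      AlmostInvariant.InGoodPosition Y ∧
      IsPartialOrder (AlmostInvariant.translates Y)
        (fun U V => AlmostInvariant.AlmostLE (U : Set G) (V : Set G)) := by
  obtain ⟨Y, hY⟩ := mainTheorem4_general H hH X hX
  exact ⟨H, Y, hH, hY⟩
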